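/- \textbf{Notation.} $\|\cdot\|$ is the Euclidean norm of a vector or the operator $2$-norm of a matrix; for a random matrix $M$ put $\|M\|_q=(\mathbb E\|M\|^q)^{1/q}$ and $\|M\|_{\psi_2}=\inf\{t>0:\ \mathbb E\exp(\|M\|^2/t^2)\le 2\}$. $\sigma_{\min}$ is the smallest singular value. For a square matrix with a singular value decomposition $A=\sum_i\sigma_iu_iv_i^\top$ put $\operatorname{clip}_\lambda(A)=\sum_i\max(\lambda,\sigma_i)u_iv_i^\top$ (if $A$ is singular, any choice of the decomposition is allowed). For $r\ge1$, $a,b>0$, $K\ge0$ and constants $C_1,C_2,C_3>0$ let $$\gamma(r;a,b,K)=\frac2b+C_1\frac{r^{1/r}K^{1/r}}{b^{2(1+1/r)}}\exp\Big(C_2K^2\frac{(r+1)^2\log^2(a/b)}{r(b-a)^2}\Big)+\frac1a\exp\Big(-\frac{C_3b^2}{rK^2}\Big),$$ where the last summand is read as $0$ if $K=0$, and the quotient in the first exponential is read as $0$ if $a=b$. \textbf{Theorem.} For all $d_x,d_y$ there are constants $C,C_1,C_2,C_3>0$, depending only on $d_x$ and $d_y$, such that the following holds for all integers $n\ge 0$,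 $N\ge1$ and all reals $\lambda>0$, $q\ge2$, $\epsilon>0$, and $\sigma$ with $\sigma^2>\lambda$. Let $Y^\star\in\mathbb R^{n\times d_y}$, $X^\star\in\mathbb R^{n\times d_x}$ and $0\ne\theta^\star\in\mathbb R^{d_x\times d_y}$ be deterministic, with $Y^\star=X^\star\theta^\star$; let $y_i^\star$, $x_i^\star$ denote the rows of $Y^\star$, $X^\star$. Let $(z_i,x_i,y_i)$, $i=1,\dots,n$, be random vectors in $\mathbb R^{d_x}\times\mathbb R^{d_x}\times\mathbb R^{d_y}$ with $z_i$ integrable, and let $Z,X,Y$ be the matrices with rows $z_i,x_i,y_i$. Suppose that (a) for finite $\bar\nu_{zy},\bar\nu_{zx},\tilde\nu_{zy},\tilde\nu_{zx}\ge0$ and all $i$, $$\|\mathbb E[z_iy_i^\top-z_i(y_i^\star)^\top]\|\le\bar\nu_{zy},\quad \|\mathbb E[z_ix_i^\top-z_i(x_i^\star)^\top]\|\le\bar\nu_{zx},\quad \|z_iy_i^\top-\mathbb E z_iy_i^\top\|_{\psi_2}\le\tilde\nu_{zy},\quad \|z_ix_i^\top-\mathbb E z_ix_i^\top\|_{\psi_2}\le\tilde\nu_{zx};$$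 (b) the data are independent at lag $N$ or more: for every set $I\subseteq\{1,\dots,n\}$ with $|i-i'|\ge N$ for all distinct $i,i'\in I$, the family $(x_i,y_i,z_i)_{i\in I}$ is (mutually) independent; (c) $\sigma_{\min}(\mathbb E Z^\top X)\ge\sigma^2$. Then $\hat\theta=\big(\operatorname{clip}_\lambda(Z^\top X)\big)^{-1}Z^\top Y$ satisfies $$\frac{\|\hat\theta-\theta^\star\|_q}{\|\theta^\star\|}\le\gamma\big(q;\lambda,\sigma^2-\lambda,\sqrt{nN}\,\tilde\nu_{zx}\big)\lambda+C\sqrt{q(1+1/\epsilon)}\;\gamma\big(q(1+1/\epsilon);\lambda,\sigma^2-\lambda,\sqrt{nN}\,\tilde\nu_{zx}\big)\Big\{n\big(\bar\nu_{zx}+\|\theta^\star\|^{-1}\bar\nu_{zy}\big)+\sqrt{nN}\big(\tilde\nu_{zx}+\|\theta^\star\|^{-1}\tilde\nu_{zy}\big)\Big\}.$$ -/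

import Mathlib

open MeasureTheory ProbabilityTheory
open scoped ENNReal NNReal Matrix Matrix.Norms.L2Operator

/-- Entrywise expectation of a random matrix. -/
noncomputable def matrixExpectation {Ω : Type*} [MeasurableSpace Ω] (μ : Measure Ω) {k l : ℕ}
    (M : Ω → Matrix (Fin k) (Fin l) ℝ) : Matrix (Fin k) (Fin l) ℝ :=
  Matrix.of fun a b => ∫ ω, M ω a b ∂μ

/-- The sub-gaussian norm `inf {t > 0 : E exp (‖X‖² / t²) ≤ 2}`, where `‖·‖` is the operator
2-norm. It takes values in `[0, ∞]`: the infimum is `∞` if there is no such `t`. -/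
noncomputable def subgaussianNorm {Ω : Type*} [MeasurableSpace Ω] (μ : Measure Ω) {k l : ℕ}
    (M : Ω → Matrix (Fin k) (Fin l) ℝ) : ℝ≥0∞ :=
  sInf {τ : ℝ≥0∞ | ∃ t : ℝ, 0 < t ∧ τ = ENNReal.ofReal t ∧
    ∫⁻ ω, ENNReal.ofReal (Real.exp (‖M ω‖ ^ 2 / t ^ 2)) ∂μ ≤ 2}

/-- The centered sub-gaussian norm `‖M - E M‖_{ψ₂}`. -/
noncomputable def centeredSubgaussianNorm {Ω : Type*} [MeasurableSpace Ω] (μ : Measure Ω)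
    {k l : ℕ} (M : Ω → Matrix (Fin k) (Fin l) ℝ) : ℝ≥0∞ :=
  subgaussianNorm μ fun ω => M ω - matrixExpectation μ M

/-- The smallest singular value of a square matrix of size `d ≥ 1`
(singular values are listed in decreasing order, starting from index `0`). -/
noncomputable def sigmaMin {d : ℕ} (A : Matrix (Fin d) (Fin d) ℝ) : ℝ :=
  (Matrix.toEuclideanLin A).singularValues (d - 1)

/-- `A = U diag(s) Vᵀ` is a singular value decomposition of the square matrix `A`; the columns of
the orthogonal matrices `U`, `V` are the singular vectors. -/
structure IsSVD {d : ℕ} (A U : Matrix (Fin d) (Fin d) ℝ) (s : Fin d → ℝ)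
    (V : Matrix (Fin d) (Fin d) ℝ) : Prop where
  orthogonal_left : U ∈ Matrix.orthogonalGroup (Fin d) ℝ
  orthogonal_right : V ∈ Matrix.orthogonalGroup (Fin d) ℝ
  nonneg : ∀ i, 0 ≤ s i
  eq : A = U * Matrix.diagonal s * Vᵀ

/-- `S` is a singular value clipping of `A` at level `lam`: each singular value `s i` in some
singular value decomposition of `A` is replaced by `max lam (s i)`. If `A` is singular the result
may depend on the decomposition, hence a relation instead of a function. -/
def IsSingularValueClip {d : ℕ} (lam : ℝ) (A S : Matrix (Fin d) (Fin d) ℝ) : Prop :=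
  ∃ (U : Matrix (Fin d) (Fin d) ℝ) (s : Fin d → ℝ) (V : Matrix (Fin d) (Fin d) ℝ),
    IsSVD A U s V ∧ S = U * Matrix.diagonal (fun i => max lam (s i)) * Vᵀ

noncomputable def gammaHead (b : ℝ) : ℝ := 2 / b

noncomputable def gammaBody (C₁ C₂ r a b K : ℝ) : ℝ :=
  C₁ * (r ^ (1 / r) * K ^ (1 / r) / b ^ (2 * (1 + 1 / r))) *
    Real.exp (C₂ * K ^ 2 * ((r + 1) ^ 2 * Real.log (a / b) ^ 2 / (r * (b - a) ^ 2)))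

open Classical in
/-- `exp (-C₃ b² / (r K²)) / a`, with the limiting value `0` for `K = 0`. -/
noncomputable def gammaTail (C₃ r a b K : ℝ) : ℝ :=
  if K = 0 then 0 else Real.exp (-(C₃ * b ^ 2 / (r * K ^ 2))) / a

/-- The sensitivity function `γ(r; a, b, K)`, with the three constants it contains. -/
noncomputable def gammaFun (C₁ C₂ C₃ r a b K : ℝ) : ℝ :=
  gammaHead b + gammaBody C₁ C₂ r a b K + gammaTail C₃ r a b K

section ScalarSubgaussian

theorem Real.exp_le_add_exp_sq (x : ℝ) : Real.exp x ≤ x + Real.exp (x ^ 2) := by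
  have h2 := Real.add_one_le_exp (x ^ 2)
  by_cases hx : |x| ≤ 1
  · have h1 := (abs_le.1 (Real.abs_exp_sub_one_sub_id_le hx)).2
    linarith
  · rw [not_le, lt_abs] at hx
    rcases hx with hx | hx
    · have : Real.exp x ≤ Real.exp (x ^ 2) := Real.exp_le_exp.2 (by nlinarith)
      linarith
    · have : Real.exp x ≤ 1 := Real.exp_le_one_iff.2 (by linarith)
      nlinarith

theorem Real.exp_mul_le_of_le_one {p : ℝ} (hp0 : 0 ≤ p) (hp1 : p ≤ 1) (u : ℝ) :
    Real.exp (p * u) ≤ 1 - p + p * Real.exp u := by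
  have := convexOn_exp.2 (Set.mem_univ (0 : ℝ)) (Set.mem_univ u)
    (sub_nonneg.2 hp1) hp0 (by ring)
  simpa using this

variable {Ω : Type*} [MeasurableSpace Ω] {μ : Measure Ω}

theorem integrable_exp_sq_of_lintegral_le {X : Ω → ℝ} (hX : AEMeasurable X μ) {t : ℝ}
    (h : ∫⁻ ω, ENNReal.ofReal (Real.exp (X ω ^ 2 / t ^ 2)) ∂μ ≤ 2) :
    Integrable (fun ω => Real.exp (X ω ^ 2 / t ^ 2)) μ ∧
      ∫ ω, Real.exp (X ω ^ 2 / t ^ 2) ∂μ ≤ 2 := by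
  have hm : AEStronglyMeasurable (fun ω => Real.exp (X ω ^ 2 / t ^ 2)) μ :=
    (by fun_prop : AEMeasurable (fun ω => Real.exp (X ω ^ 2 / t ^ 2)) μ).aestronglyMeasurable
  have hnn : 0 ≤ᵐ[μ] fun ω => Real.exp (X ω ^ 2 / t ^ 2) := ae_of_all _ fun ω => by positivity
  refine ⟨⟨hm, ?_⟩, ?_⟩
  · rw [hasFiniteIntegral_iff_ofReal hnn]
    exact h.trans_lt (by simp)
  · rw [integral_eq_lintegral_of_nonneg_ae hnn hm]
    exact ENNReal.toReal_le_of_le_ofReal (by norm_num) (by simpa using h)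

theorem integrable_of_lintegral_exp_sq_le {X : Ω → ℝ} (hX : AEMeasurable X μ) {t : ℝ}
    (ht : 0 < t) (h : ∫⁻ ω, ENNReal.ofReal (Real.exp (X ω ^ 2 / t ^ 2)) ∂μ ≤ 2) :
    Integrable X μ := by
  refine ((integrable_exp_sq_of_lintegral_le hX h).1.const_mul t).mono'
    hX.aestronglyMeasurable (ae_of_all _ fun ω => ?_)
  have h1 := Real.add_one_le_exp (X ω ^ 2 / t ^ 2)
  have h2 : |X ω| / t ≤ X ω ^ 2 / t ^ 2 + 1 := by
    rw [← sq_abs, ← div_pow]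
    nlinarith [sq_nonneg (|X ω| / t - 1), sq_nonneg (|X ω| / t)]
  rw [Real.norm_eq_abs, mul_comm, ← div_le_iff₀ ht]
  linarith

/-- A centered random variable with `ψ₂`-norm at most `t` has a sub-Gaussian moment generating
function with variance proxy `2 t²`. -/
theorem hasSubgaussianMGF_of_lintegral_exp_sq_le [IsProbabilityMeasure μ]
    {X : Ω → ℝ} (hX : AEMeasurable X μ)
    (hmean : ∫ ω, X ω ∂μ = 0) {t : ℝ≥0} (ht : 0 < t)
    (h : ∫⁻ ω, ENNReal.ofReal (Real.exp (X ω ^ 2 / (t : ℝ) ^ 2)) ∂μ ≤ 2) :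
    HasSubgaussianMGF X (2 * t ^ 2) μ := by
  have ht' : (0 : ℝ) < t := ht
  obtain ⟨hE, hE2⟩ := integrable_exp_sq_of_lintegral_le hX h
  have hXi := integrable_of_lintegral_exp_sq_le hX ht' h
  have key (s x : ℝ) : Real.exp (s * x) ≤
      Real.exp (s ^ 2 * t ^ 2 / 2) * Real.exp (1 / 2 * (x ^ 2 / (t : ℝ) ^ 2)) := by
    rw [← Real.exp_add, Real.exp_le_exp]
    have : x ^ 2 / (t : ℝ) ^ 2 = (x / t) ^ 2 := by rw [div_pow]
    have h3 : s * x = (s * t) * (x / t) := by field_simp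
    rw [this, h3]
    nlinarith [sq_nonneg (s * t - x / t)]
  have hint (s : ℝ) : Integrable (fun ω => Real.exp (s * X ω)) μ := by
    refine (hE.const_mul (Real.exp (s ^ 2 * t ^ 2 / 2))).mono'
      (by fun_prop : AEMeasurable (fun ω => Real.exp (s * X ω)) μ).aestronglyMeasurable
      (ae_of_all _ fun ω => ?_)
    rw [Real.norm_eq_abs, abs_of_pos (Real.exp_pos _)]
    refine (key s (X ω)).trans ?_
    gcongr
    have : 0 ≤ X ω ^ 2 / (t : ℝ) ^ 2 := by positivity
    linarith
  refine ⟨hint, fun s => ?_⟩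
  have hgoal : ((2 * t ^ 2 : ℝ≥0) : ℝ) * s ^ 2 / 2 = s ^ 2 * t ^ 2 := by push_cast; ring
  rw [hgoal, mgf]
  have hp0 : 0 ≤ s ^ 2 * (t : ℝ) ^ 2 := by positivity
  by_cases hp : s ^ 2 * (t : ℝ) ^ 2 ≤ 1
  · calc ∫ ω, Real.exp (s * X ω) ∂μ
        ≤ ∫ ω, (s * X ω + ((1 - s ^ 2 * t ^ 2) +
            s ^ 2 * t ^ 2 * Real.exp (X ω ^ 2 / (t : ℝ) ^ 2))) ∂μ := by
          refine integral_mono (hint s) ((hXi.const_mul s).add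
            ((integrable_const _).add (hE.const_mul _))) fun ω => ?_
          refine (Real.exp_le_add_exp_sq (s * X ω)).trans ?_
          have := Real.exp_mul_le_of_le_one hp0 hp (X ω ^ 2 / (t : ℝ) ^ 2)
          have h3 : s ^ 2 * (t : ℝ) ^ 2 * (X ω ^ 2 / (t : ℝ) ^ 2) = (s * X ω) ^ 2 := by
            field_simp
          rw [h3] at this
          show s * X ω + Real.exp ((s * X ω) ^ 2) ≤ _
          gcongr
      _ = (1 - s ^ 2 * t ^ 2) + s ^ 2 * t ^ 2 * ∫ ω, Real.exp (X ω ^ 2 / (t : ℝ) ^ 2) ∂μ := by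
          have hi : Integrable (fun ω => (1 - s ^ 2 * (t : ℝ) ^ 2) +
              s ^ 2 * t ^ 2 * Real.exp (X ω ^ 2 / (t : ℝ) ^ 2)) μ :=
            (integrable_const _).add (hE.const_mul _)
          rw [integral_add (hXi.const_mul s) hi, integral_add (integrable_const _) (hE.const_mul _),
            integral_const_mul,
            integral_const_mul, hmean]
          simp
      _ ≤ s ^ 2 * t ^ 2 + 1 := by nlinarith
      _ ≤ Real.exp (s ^ 2 * t ^ 2) := Real.add_one_le_exp _
  · calc ∫ ω, Real.exp (s * X ω) ∂μ
        ≤ ∫ ω, Real.exp (s ^ 2 * t ^ 2 / 2) *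
            ((1 - 1 / 2) + 1 / 2 * Real.exp (X ω ^ 2 / (t : ℝ) ^ 2)) ∂μ := by
          refine integral_mono (hint s) (((integrable_const _).add
            (hE.const_mul _)).const_mul _) fun ω => (key s (X ω)).trans ?_
          gcongr
          exact Real.exp_mul_le_of_le_one (by norm_num) (by norm_num) _
      _ = Real.exp (s ^ 2 * t ^ 2 / 2) *
            ((1 - 1 / 2) + 1 / 2 * ∫ ω, Real.exp (X ω ^ 2 / (t : ℝ) ^ 2) ∂μ) := by
          rw [integral_const_mul, integral_add (integrable_const _) (hE.const_mul _),
            integral_const_mul]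
          simp
      _ ≤ Real.exp (s ^ 2 * t ^ 2 / 2) * Real.exp (1 / 2) := by
          gcongr
          have := Real.add_one_le_exp (1 / 2)
          linarith
      _ ≤ Real.exp (s ^ 2 * t ^ 2) := by
          rw [← Real.exp_add, Real.exp_le_exp]
          linarith

theorem ProbabilityTheory.HasSubgaussianMGF.mono {X : Ω → ℝ} {c c' : ℝ≥0}
    (h : HasSubgaussianMGF X c μ) (hc : c ≤ c') : HasSubgaussianMGF X c' μ :=
  ⟨h.integrable_exp_mul, fun t => (h.mgf_le t).trans (by gcongr)⟩

theorem hasSubgaussianMGF_of_forall_gt {X : Ω → ℝ} {ν : ℝ≥0}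
    (h : ∀ t : ℝ≥0, ν < t → HasSubgaussianMGF X (2 * t ^ 2) μ) :
    HasSubgaussianMGF X (2 * ν ^ 2) μ := by
  refine ⟨(h (ν + 1) (by simp)).integrable_exp_mul, fun s => ?_⟩
  have hcont : Continuous fun t : ℝ≥0 => Real.exp (((2 * t ^ 2 : ℝ≥0) : ℝ) * s ^ 2 / 2) := by
    fun_prop
  refine ge_of_tendsto (hcont.continuousWithinAt (s := Set.Ioi ν) (x := ν)).tendsto ?_
  filter_upwards [self_mem_nhdsWithin] with t ht
  exact (h t ht).mgf_le s

theorem ProbabilityTheory.HasSubgaussianMGF.sum_of_dependent [IsProbabilityMeasure μ]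
    {ι : Type*} (s : Finset ι) {X : ι → Ω → ℝ}
    {c : ι → ℝ≥0} (h : ∀ i ∈ s, HasSubgaussianMGF (X i) (c i) μ) :
    HasSubgaussianMGF (fun ω => ∑ i ∈ s, X i ω) ((∑ i ∈ s, (c i).sqrt) ^ 2) μ := by
  classical
  induction s using Finset.induction_on with
  | empty => simp
  | insert i s hi ih =>
    have := (h i (Finset.mem_insert_self _ _)).add
      (ih fun j hj => h j (Finset.mem_insert_of_mem hj))
    simpa [Finset.sum_insert hi] using this

theorem ProbabilityTheory.HasSubgaussianMGF.measure_abs_ge_le [IsProbabilityMeasure μ]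
    {T : Ω → ℝ} {c : ℝ≥0} (h : HasSubgaussianMGF T c μ) {t : ℝ}
    (ht : 0 ≤ t) : μ.real {ω | t ≤ |T ω|} ≤ 2 * Real.exp (-t ^ 2 / (2 * c)) := by
  have hsub : {ω | t ≤ |T ω|} ⊆ {ω | t ≤ T ω} ∪ {ω | t ≤ (-T) ω} := fun ω hω => by
    simpa [le_abs] using hω
  calc μ.real {ω | t ≤ |T ω|} ≤ μ.real ({ω | t ≤ T ω} ∪ {ω | t ≤ (-T) ω}) :=
        measureReal_mono hsub
    _ ≤ μ.real {ω | t ≤ T ω} + μ.real {ω | t ≤ (-T) ω} := measureReal_union_le _ _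
    _ ≤ 2 * Real.exp (-t ^ 2 / (2 * c)) := by
        have := h.measure_ge_le ht
        have := h.neg.measure_ge_le ht
        linarith

/-- Moments of a sub-Gaussian random variable grow like the square root of the order. -/
theorem ProbabilityTheory.HasSubgaussianMGF.eLpNorm_le [IsProbabilityMeasure μ]
    {T : Ω → ℝ} {c : ℝ≥0} (h : HasSubgaussianMGF T c μ)
    {p : ℝ} (hp : 1 ≤ p) :
    eLpNorm T (ENNReal.ofReal p) μ ≤ ENNReal.ofReal (4 * √(p * c)) := by
  have hp0 : 0 < p := by linarith
  rcases eq_or_ne c 0 with rfl | hc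
  · rw [eLpNorm_congr_ae h.ae_eq_zero_of_hasSubgaussianMGF_zero]
    simp
  have hc' : (0 : ℝ) < c := by positivity
  set η : ℝ := √(p / c) with hη
  have hηpos : 0 < η := Real.sqrt_pos.2 (by positivity)
  have hη2 : c * η ^ 2 / 2 = p / 2 := by
    rw [hη, Real.sq_sqrt (by positivity)]; field_simp
  have hpη : p / η = √(p * c) := by
    rw [div_eq_iff hηpos.ne', hη, ← Real.sqrt_mul (by positivity)]
    rw [show p * c * (p / c) = p ^ 2 by field_simp, Real.sqrt_sq hp0.le]
  have hpt (ω : Ω) : |T ω| ^ p ≤ (p / η) ^ p *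
      (Real.exp (η * T ω) + Real.exp (-η * T ω)) := by
    have h1 : |T ω| ≤ (p / η) * Real.exp (η * |T ω| / p) := by
      have := Real.add_one_le_exp (η * |T ω| / p)
      have h2 : |T ω| = (p / η) * (η * |T ω| / p) := by field_simp
      calc |T ω| = (p / η) * (η * |T ω| / p) := h2
        _ ≤ _ := by gcongr; linarith
    calc |T ω| ^ p ≤ ((p / η) * Real.exp (η * |T ω| / p)) ^ p := by gcongr
      _ = (p / η) ^ p * Real.exp (η * |T ω|) := by
        rw [Real.mul_rpow (by positivity) (by positivity), ← Real.exp_mul]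
        congr 2; field_simp
      _ ≤ _ := by
        gcongr
        rcases abs_cases (T ω) with ⟨h, _⟩ | ⟨h, _⟩ <;> rw [h]
        · linarith [Real.exp_pos (-η * T ω)]
        · rw [show η * -T ω = -η * T ω by ring]; linarith [Real.exp_pos (η * T ω)]
  have hi1 := h.integrable_exp_mul η
  have hi2 := h.integrable_exp_mul (-η)
  have hb : ∫ ω, (p / η) ^ p * (Real.exp (η * T ω) + Real.exp (-η * T ω)) ∂μ ≤
      (4 * √(p * c)) ^ p := by
    rw [integral_const_mul, integral_add hi1 hi2]
    have m1 := h.mgf_le η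
    have m2 := h.mgf_le (-η)
    rw [neg_sq, hη2] at m2
    rw [hη2] at m1
    rw [mgf] at m1 m2
    rw [hpη, mul_comm 4, Real.mul_rpow (by positivity) (by norm_num)]
    gcongr
    have h4 : (2 : ℝ) ≤ 2 ^ p := Real.self_le_rpow_of_one_le (by norm_num) hp
    have h5 : Real.exp (p / 2) ≤ 2 ^ p := by
      rw [Real.rpow_def_of_pos (by norm_num), Real.exp_le_exp]
      nlinarith [Real.log_two_gt_d9]
    calc _ ≤ 2 * Real.exp (p / 2) := by linarith
      _ ≤ 2 ^ p * 2 ^ p := by gcongr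
      _ = 4 ^ p := by rw [← Real.mul_rpow (by norm_num) (by norm_num)]; norm_num
  rw [eLpNorm_eq_lintegral_rpow_enorm_toReal (by simpa using hp0) (by simp),
    ENNReal.toReal_ofReal hp0.le]
  have hlin : ∫⁻ ω, ‖T ω‖ₑ ^ p ∂μ ≤ ENNReal.ofReal ((4 * √(p * c)) ^ p) := by
    calc ∫⁻ ω, ‖T ω‖ₑ ^ p ∂μ ≤ ∫⁻ ω, ENNReal.ofReal ((p / η) ^ p *
          (Real.exp (η * T ω) + Real.exp (-η * T ω))) ∂μ := by
          refine lintegral_mono fun ω => ?_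
          show ‖T ω‖ₑ ^ p ≤ _
          rw [Real.enorm_eq_ofReal_abs, ENNReal.ofReal_rpow_of_nonneg (abs_nonneg _) hp0.le]
          exact ENNReal.ofReal_le_ofReal (hpt ω)
      _ = ENNReal.ofReal (∫ ω, (p / η) ^ p *
          (Real.exp (η * T ω) + Real.exp (-η * T ω)) ∂μ) := by
          refine (ofReal_integral_eq_lintegral_ofReal ((hi1.add hi2).const_mul _) ?_).symm
          refine ae_of_all _ fun ω => ?_
          show 0 ≤ (p / η) ^ p * (Real.exp (η * T ω) + Real.exp (-η * T ω))
          positivity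
      _ ≤ _ := ENNReal.ofReal_le_ofReal hb
  calc _ ≤ (ENNReal.ofReal ((4 * √(p * c)) ^ p)) ^ (1 / p) := by gcongr
    _ = _ := by
      rw [ENNReal.ofReal_rpow_of_nonneg (by positivity) (by positivity), ← Real.rpow_mul
        (by positivity), mul_one_div_cancel hp0.ne', Real.rpow_one]

end ScalarSubgaussian

section RandomMatrix

variable {Ω : Type*} [MeasurableSpace Ω] {μ : Measure Ω}

/-- A sum of sub-Gaussian variables that are independent at lag `N` or more: the residue classes
modulo `N` are independent, and the `N` partial sums over them are combined without
independence. -/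
theorem ProbabilityTheory.HasSubgaussianMGF.sum_of_lag_indep [IsProbabilityMeasure μ]
    {n N : ℕ} (hN : 1 ≤ N)
    {X : Fin n → Ω → ℝ} {c : ℝ≥0} (h : ∀ i, HasSubgaussianMGF (X i) c μ)
    (hindep : ∀ I : Finset (Fin n),
      (∀ i ∈ I, ∀ j ∈ I, i ≠ j → (N : ℤ) ≤ |((i : ℕ) : ℤ) - ((j : ℕ) : ℤ)|) →
      iIndepFun (fun (i : I) ω => X i ω) μ) :
    HasSubgaussianMGF (fun ω => ∑ i, X i ω) (n * N * c) μ := by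
  classical
  let I : ℕ → Finset (Fin n) := fun j => Finset.univ.filter fun i => (i : ℕ) % N = j
  have hmaps : ∀ i ∈ (Finset.univ : Finset (Fin n)), (i : ℕ) % N ∈ Finset.range N := fun i _ =>
    Finset.mem_range.2 (Nat.mod_lt _ hN)
  have hblock (j : ℕ) :
      HasSubgaussianMGF (fun ω => ∑ i ∈ I j, X i ω) ((I j).card * c) μ := by
    have hI := hindep (I j) fun i hi i' hi' hne => by
      have h1 : (i : ℕ) % N = j := (Finset.mem_filter.1 hi).2
      have h2 : (i' : ℕ) % N = j := (Finset.mem_filter.1 hi').2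
      have h3 : (N : ℤ) ∣ ((i : ℕ) : ℤ) - ((i' : ℕ) : ℤ) :=
        (Nat.modEq_iff_dvd.1 (h2.trans h1.symm))
      refine Int.le_of_dvd (abs_pos.2 (sub_ne_zero.2 fun h => hne ?_)) ((dvd_abs _ _).2 h3)
      exact Fin.ext (by exact_mod_cast h)
    have := HasSubgaussianMGF.sum_of_iIndepFun hI (c := fun _ => c) (s := Finset.univ)
      fun i _ => h i
    refine (this.congr (ae_of_all _ fun ω => ?_)).mono (by simp)
    exact Finset.sum_coe_sort (I j) fun i => X i ω
  have hsum := HasSubgaussianMGF.sum_of_dependent (Finset.range N) fun j _ => hblock j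
  refine (hsum.congr (ae_of_all _ fun ω => ?_)).mono ?_
  · exact Finset.sum_fiberwise_of_maps_to hmaps _
  · have hcard : ∑ j ∈ Finset.range N, (I j).card = n := by
      rw [← Finset.card_eq_sum_card_fiberwise hmaps]; simp
    have hcard' : ∑ j ∈ Finset.range N, ((I j).card : ℝ) = n := by exact_mod_cast hcard
    rw [← NNReal.coe_le_coe]
    push_cast
    refine (sq_sum_le_card_mul_sum_sq).trans_eq ?_
    have hsq (j : ℕ) : √((I j).card * (c : ℝ)) ^ 2 = (I j).card * c :=
      Real.sq_sqrt (by positivity)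
    simp_rw [hsq]
    rw [← Finset.sum_mul, hcard', Finset.card_range]
    ring

theorem Matrix.abs_entry_le_l2_opNorm {k l : ℕ} (M : Matrix (Fin k) (Fin l) ℝ) (a : Fin k)
    (b : Fin l) : |M a b| ≤ ‖M‖ := by
  have h := Matrix.l2_opNorm_mulVec M (EuclideanSpace.single b (1 : ℝ))
  have h2 := PiLp.norm_apply_le (WithLp.toLp 2 (M *ᵥ (EuclideanSpace.single b (1 : ℝ)))) a
  have h3 : (M *ᵥ (EuclideanSpace.single b (1 : ℝ)).ofLp) a = M a b := by simp
  simp only [PiLp.norm_single, norm_one, mul_one] at h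
  calc |M a b| = ‖(M *ᵥ (EuclideanSpace.single b (1 : ℝ)).ofLp) a‖ := by
        rw [h3, Real.norm_eq_abs]
    _ ≤ _ := h2
    _ ≤ ‖M‖ := h

theorem EuclideanSpace.norm_le_sum_abs {k : ℕ} (w : EuclideanSpace ℝ (Fin k)) :
    ‖w‖ ≤ ∑ a, |w a| := by
  rw [EuclideanSpace.norm_eq, Real.sqrt_le_left (by positivity)]
  simpa using Finset.sum_sq_le_sq_sum_of_nonneg
    (s := Finset.univ) (f := fun a => |w a|) fun a _ => abs_nonneg _

theorem Matrix.l2_opNorm_le_sum_abs {k l : ℕ} (M : Matrix (Fin k) (Fin l) ℝ) :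
    ‖M‖ ≤ ∑ a, ∑ b, |M a b| := by
  rw [Matrix.l2_opNorm_def]
  refine ContinuousLinearMap.opNorm_le_bound _ (by positivity) fun v => ?_
  refine (EuclideanSpace.norm_le_sum_abs _).trans ?_
  rw [Finset.sum_mul]
  refine Finset.sum_le_sum fun a _ => ?_
  rw [Finset.sum_mul]
  have heq : (M *ᵥ v.ofLp) a = ∑ b, M a b * v b := rfl
  show |(M *ᵥ v.ofLp) a| ≤ _
  rw [heq]
  refine (Finset.abs_sum_le_sum_abs _ _).trans (Finset.sum_le_sum fun b _ => ?_)
  rw [abs_mul]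
  gcongr
  exact PiLp.norm_apply_le v b

theorem lintegral_exp_sq_le_of_subgaussianNorm_lt {k l : ℕ} {M : Ω → Matrix (Fin k) (Fin l) ℝ}
    {t : ℝ≥0} (h : subgaussianNorm μ M < t) :
    ∫⁻ ω, ENNReal.ofReal (Real.exp (‖M ω‖ ^ 2 / (t : ℝ) ^ 2)) ∂μ ≤ 2 := by
  obtain ⟨τ, ⟨s, hs, rfl, hle⟩, hlt⟩ := sInf_lt_iff.1 h
  refine (lintegral_mono fun ω => ENNReal.ofReal_le_ofReal (Real.exp_le_exp.2 ?_)).trans hle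
  have : s ≤ t := by
    have := ENNReal.ofReal_lt_coe_iff hs.le |>.1 hlt
    exact_mod_cast this.le
  gcongr

theorem entry_subgaussian [IsProbabilityMeasure μ] {k l : ℕ} {M : Ω → Matrix (Fin k) (Fin l) ℝ}
    (hM : ∀ a b, Measurable fun ω => M ω a b) {ν : ℝ≥0} (h : centeredSubgaussianNorm μ M ≤ ν)
    (a : Fin k) (b : Fin l) :
    Integrable (fun ω => M ω a b) μ ∧
      HasSubgaussianMGF (fun ω => M ω a b - matrixExpectation μ M a b) (2 * ν ^ 2) μ := by
  have hlin (t : ℝ≥0) (ht : ν < t) : ∫⁻ ω, ENNReal.ofReal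
      (Real.exp ((M ω a b - matrixExpectation μ M a b) ^ 2 / (t : ℝ) ^ 2)) ∂μ ≤ 2 := by
    refine (lintegral_mono fun ω => ENNReal.ofReal_le_ofReal (Real.exp_le_exp.2 ?_)).trans
      (lintegral_exp_sq_le_of_subgaussianNorm_lt (h.trans_lt (ENNReal.coe_lt_coe.2 ht)))
    have := Matrix.abs_entry_le_l2_opNorm (M ω - matrixExpectation μ M) a b
    rw [Matrix.sub_apply] at this
    show _ / _ ≤ _ / _
    rw [← sq_abs]
    gcongr
  have hmeas : AEMeasurable (fun ω => M ω a b - matrixExpectation μ M a b) μ :=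
    ((hM a b).sub_const _).aemeasurable
  have hint : Integrable (fun ω => M ω a b) μ := by
    have := (integrable_of_lintegral_exp_sq_le hmeas (t := (ν + 1 : ℝ≥0))
      (by positivity) (hlin (ν + 1) (by simp))).add
      (integrable_const (matrixExpectation μ M a b))
    simpa [Pi.add_def] using this
  refine ⟨hint, hasSubgaussianMGF_of_forall_gt fun t ht =>
    hasSubgaussianMGF_of_lintegral_exp_sq_le hmeas ?_ (pos_of_gt ht) (hlin t ht)⟩
  rw [integral_sub hint (integrable_const _)]
  simp [matrixExpectation]

theorem matrixExpectation_transpose_mul {n k l : ℕ} {z : Fin n → Ω → Fin k → ℝ}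
    {w : Fin n → Ω → Fin l → ℝ} {Z : Ω → Matrix (Fin n) (Fin k) ℝ}
    {W : Ω → Matrix (Fin n) (Fin l) ℝ} (hZ : ∀ ω i, Z ω i = z i ω) (hW : ∀ ω i, W ω i = w i ω)
    (hint : ∀ i a b, Integrable (fun ω => Matrix.vecMulVec (z i ω) (w i ω) a b) μ) :
    matrixExpectation μ (fun ω => (Z ω)ᵀ * W ω) =
      ∑ i, matrixExpectation μ fun ω => Matrix.vecMulVec (z i ω) (w i ω) := by
  ext a b
  rw [Matrix.sum_apply]
  simp only [matrixExpectation, Matrix.of_apply, Matrix.mul_apply, Matrix.transpose_apply, hZ, hW]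
  exact integral_finsetSum _ fun i _ => hint i a b

/-- Entrywise sub-Gaussian concentration of the empirical cross-moment matrix `Zᵀ W`. -/
theorem crossMoment_entry_subgaussian [IsProbabilityMeasure μ]
    {n N k l : ℕ} (hN : 1 ≤ N) {z : Fin n → Ω → Fin k → ℝ}
    {w : Fin n → Ω → Fin l → ℝ} (hz : ∀ i, Measurable (z i)) (hw : ∀ i, Measurable (w i))
    {ν : ℝ≥0} (hν : ∀ i, centeredSubgaussianNorm μ
      (fun ω => Matrix.vecMulVec (z i ω) (w i ω)) ≤ ν)
    (hindep : ∀ I : Finset (Fin n),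
      (∀ i ∈ I, ∀ j ∈ I, i ≠ j → (N : ℤ) ≤ |((i : ℕ) : ℤ) - ((j : ℕ) : ℤ)|) →
      iIndepFun (fun (i : I) ω => (z i ω, w i ω)) μ)
    {Z : Ω → Matrix (Fin n) (Fin k) ℝ} {W : Ω → Matrix (Fin n) (Fin l) ℝ}
    (hZ : ∀ ω i, Z ω i = z i ω) (hW : ∀ ω i, W ω i = w i ω) (a : Fin k) (b : Fin l) :
    HasSubgaussianMGF (fun ω => ((Z ω)ᵀ * W ω -
      matrixExpectation μ (fun ω => (Z ω)ᵀ * W ω)) a b) (n * N * (2 * ν ^ 2)) μ := by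
  have hM (i : Fin n) (a : Fin k) (b : Fin l) :
      Measurable fun ω => Matrix.vecMulVec (z i ω) (w i ω) a b := by
    simp only [Matrix.vecMulVec_apply]
    have := hz i
    have := hw i
    fun_prop
  have hent (i : Fin n) := entry_subgaussian (hM i) (hν i)
  have := HasSubgaussianMGF.sum_of_lag_indep hN (fun i => (hent i a b).2) fun I hI => by
    have := (hindep I hI).comp (fun i (p : (Fin k → ℝ) × (Fin l → ℝ)) => p.1 a * p.2 b -
      matrixExpectation μ (fun ω => Matrix.vecMulVec (z i ω) (w i ω)) a b) fun i => by fun_prop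
    exact this
  refine this.congr (ae_of_all _ fun ω => ?_)
  rw [matrixExpectation_transpose_mul hZ hW fun i a b => (hent i a b).1]
  simp [Matrix.sum_apply, Matrix.mul_apply, Matrix.vecMulVec_apply, hZ, hW,
    Finset.sum_sub_distrib]

theorem bias_norm_le {n k l : ℕ} {z x : Fin n → Ω → Fin k → ℝ}
    {y : Fin n → Ω → Fin l → ℝ} (hz : ∀ i, Integrable (z i) μ)
    (hzx : ∀ i a b, Integrable (fun ω => Matrix.vecMulVec (z i ω) (x i ω) a b) μ)
    (hzy : ∀ i a b, Integrable (fun ω => Matrix.vecMulVec (z i ω) (y i ω) a b) μ)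
    {Ystar : Matrix (Fin n) (Fin l) ℝ} {Xstar : Matrix (Fin n) (Fin k) ℝ}
    {θstar : Matrix (Fin k) (Fin l) ℝ} (hmodel : Ystar = Xstar * θstar) {νzy νzx : ℝ}
    (hbzy : ∀ i, ‖matrixExpectation μ (fun ω =>
      Matrix.vecMulVec (z i ω) (y i ω) - Matrix.vecMulVec (z i ω) (Ystar i))‖ ≤ νzy)
    (hbzx : ∀ i, ‖matrixExpectation μ (fun ω =>
      Matrix.vecMulVec (z i ω) (x i ω) - Matrix.vecMulVec (z i ω) (Xstar i))‖ ≤ νzx) :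
    ‖(∑ i, matrixExpectation μ fun ω => Matrix.vecMulVec (z i ω) (y i ω)) -
      (∑ i, matrixExpectation μ fun ω => Matrix.vecMulVec (z i ω) (x i ω)) * θstar‖ ≤
      n * (νzx * ‖θstar‖ + νzy) := by
  have hzc (i : Fin n) (a : Fin k) : Integrable (fun ω => z i ω a) μ := (hz i).eval a
  have hsub {m : ℕ} (w : Fin n → Ω → Fin m → ℝ) (u : Fin n → Fin m → ℝ)
      (hw : ∀ i a b, Integrable (fun ω => Matrix.vecMulVec (z i ω) (w i ω) a b) μ) (i : Fin n) :
      matrixExpectation μ (fun ω =>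
        Matrix.vecMulVec (z i ω) (w i ω) - Matrix.vecMulVec (z i ω) (u i)) =
      matrixExpectation μ (fun ω => Matrix.vecMulVec (z i ω) (w i ω)) -
        Matrix.vecMulVec (fun a => ∫ ω, z i ω a ∂μ) (u i) := by
    ext a b
    simp only [matrixExpectation, Matrix.of_apply, Matrix.sub_apply]
    rw [integral_sub (hw i a b) (by simpa [Matrix.vecMulVec_apply] using (hzc i a).mul_const _)]
    simp [Matrix.vecMulVec_apply, integral_mul_const]
  have hrow (i : Fin n) (v : Fin k → ℝ) :
      Matrix.vecMulVec v (Ystar i) = Matrix.vecMulVec v (Xstar i) * θstar := by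
    rw [hmodel]
    ext a b
    simp [Matrix.vecMulVec_apply, Matrix.mul_apply, Finset.mul_sum, mul_assoc]
  rw [Matrix.sum_mul, ← Finset.sum_sub_distrib]
  refine (norm_sum_le _ _).trans ((Finset.sum_le_card_nsmul _ _
    (νzx * ‖θstar‖ + νzy) fun i _ => ?_).trans_eq
    (by rw [nsmul_eq_mul, Finset.card_univ, Fintype.card_fin]))
  have heq : matrixExpectation μ (fun ω => Matrix.vecMulVec (z i ω) (y i ω)) -
      matrixExpectation μ (fun ω => Matrix.vecMulVec (z i ω) (x i ω)) * θstar =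
      matrixExpectation μ (fun ω =>
        Matrix.vecMulVec (z i ω) (y i ω) - Matrix.vecMulVec (z i ω) (Ystar i)) -
      matrixExpectation μ (fun ω =>
        Matrix.vecMulVec (z i ω) (x i ω) - Matrix.vecMulVec (z i ω) (Xstar i)) * θstar := by
    rw [hsub y Ystar hzy, hsub x Xstar hzx, Matrix.sub_mul, hrow]
    abel
  rw [heq]
  refine (norm_sub_le _ _).trans ?_
  have h1 := Matrix.l2_opNorm_mul (matrixExpectation μ (fun ω =>
        Matrix.vecMulVec (z i ω) (x i ω) - Matrix.vecMulVec (z i ω) (Xstar i))) θstar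
  have h2 := mul_le_mul_of_nonneg_right (hbzx i) (norm_nonneg θstar)
  linarith [hbzy i]

end RandomMatrix

section SingularValueClip

theorem LinearMap.singularValues_mul_norm_le {E F : Type*} [NormedAddCommGroup E]
    [InnerProductSpace ℝ E] [FiniteDimensional ℝ E] [NormedAddCommGroup F]
    [InnerProductSpace ℝ F] [FiniteDimensional ℝ F] (T : E →ₗ[ℝ] F) {d : ℕ}
    (hd : Module.finrank ℝ E = d) (v : E) :
    T.singularValues (d - 1) * ‖v‖ ≤ ‖T v‖ := by
  refine le_of_sq_le_sq ?_ (norm_nonneg _)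
  let hS := T.isSymmetric_adjoint_comp_self
  let e := hS.eigenvectorBasis hd
  have hcoord (i : Fin d) : inner ℝ (e i) (LinearMap.adjoint T (T v)) =
      T.singularValues i ^ 2 * inner ℝ (e i) v := by
    have := hS.eigenvectorBasis_apply_self_apply hd v i
    rw [OrthonormalBasis.repr_apply_apply, OrthonormalBasis.repr_apply_apply] at this
    rw [T.sq_singularValues_fin hd]
    exact this
  calc (T.singularValues (d - 1) * ‖v‖) ^ 2
      = ∑ i, T.singularValues (d - 1) ^ 2 * inner ℝ (e i) v ^ 2 := by
        rw [mul_pow, ← Finset.mul_sum]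
        congr 1
        rw [← e.sum_sq_norm_inner_right v]
        simp
    _ ≤ ∑ i : Fin d, T.singularValues i ^ 2 * inner ℝ (e i) v ^ 2 := by
        refine Finset.sum_le_sum fun i _ => ?_
        have h1 : T.singularValues (d - 1) ≤ T.singularValues i :=
          T.singularValues_antitone (by omega)
        have h2 := T.singularValues_nonneg (d - 1)
        gcongr
    _ = ∑ i, inner ℝ v (e i) * inner ℝ (e i) (LinearMap.adjoint T (T v)) := by
        refine Finset.sum_congr rfl fun i _ => ?_
        rw [hcoord, real_inner_comm]
        ring
    _ = ‖T v‖ ^ 2 := by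
        rw [e.sum_inner_mul_inner, LinearMap.adjoint_inner_right, real_inner_self_eq_norm_sq]

theorem sigmaMin_mul_norm_le {d : ℕ} (A : Matrix (Fin d) (Fin d) ℝ)
    (v : EuclideanSpace ℝ (Fin d)) : sigmaMin A * ‖v‖ ≤ ‖Matrix.toEuclideanLin A v‖ :=
  LinearMap.singularValues_mul_norm_le _ (by simp) v

theorem Matrix.l2_opNorm_le_one_of_mem_orthogonalGroup {d : ℕ} {U : Matrix (Fin d) (Fin d) ℝ}
    (hU : U ∈ Matrix.orthogonalGroup (Fin d) ℝ) : ‖U‖ ≤ 1 := by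
  have h : ‖U‖ * ‖U‖ = ‖(1 : Matrix (Fin d) (Fin d) ℝ)‖ := by
    rw [← Matrix.l2_opNorm_conjTranspose_mul_self, ← Matrix.star_eq_conjTranspose,
      (Matrix.mem_unitaryGroup_iff').1 hU]
  have h1 : ‖(1 : Matrix (Fin d) (Fin d) ℝ)‖ ≤ 1 := by
    rw [← Matrix.diagonal_one, Matrix.l2_opNorm_diagonal]
    exact (pi_norm_le_iff_of_nonneg zero_le_one).2 fun i => by simp
  nlinarith [norm_nonneg U]

theorem Matrix.l2_opNorm_orthogonal_mul_diagonal_mul_le {d : ℕ}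
    {U V : Matrix (Fin d) (Fin d) ℝ} (hU : U ∈ Matrix.orthogonalGroup (Fin d) ℝ)
    (hV : V ∈ Matrix.orthogonalGroup (Fin d) ℝ) {s : Fin d → ℝ} {c : ℝ} (hc : 0 ≤ c)
    (hs : ∀ i, |s i| ≤ c) : ‖U * Matrix.diagonal s * Vᵀ‖ ≤ c := by
  have hV' : ‖Vᵀ‖ ≤ 1 := by
    rw [← Matrix.conjTranspose_eq_transpose_of_trivial, Matrix.l2_opNorm_conjTranspose]
    exact Matrix.l2_opNorm_le_one_of_mem_orthogonalGroup hV
  have hD : ‖Matrix.diagonal s‖ ≤ c := by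
    rw [Matrix.l2_opNorm_diagonal]
    exact (pi_norm_le_iff_of_nonneg hc).2 hs
  calc ‖U * Matrix.diagonal s * Vᵀ‖ ≤ ‖U * Matrix.diagonal s‖ * ‖Vᵀ‖ := Matrix.l2_opNorm_mul _ _
    _ ≤ ‖U‖ * ‖Matrix.diagonal s‖ * ‖Vᵀ‖ := by gcongr; exact Matrix.l2_opNorm_mul _ _
    _ ≤ 1 * c * 1 := by
        gcongr
        exact Matrix.l2_opNorm_le_one_of_mem_orthogonalGroup hU
    _ = c := by ring

variable {d : ℕ} {lam : ℝ} {A S : Matrix (Fin d) (Fin d) ℝ}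

theorem IsSingularValueClip.norm_sub_le (hlam : 0 ≤ lam) (h : IsSingularValueClip lam A S) :
    ‖A - S‖ ≤ lam := by
  obtain ⟨U, s, V, hsvd, rfl⟩ := h
  rw [hsvd.eq, ← Matrix.sub_mul, ← Matrix.mul_sub, Matrix.diagonal_sub]
  refine Matrix.l2_opNorm_orthogonal_mul_diagonal_mul_le hsvd.orthogonal_left
    hsvd.orthogonal_right hlam fun i => ?_
  have := hsvd.nonneg i
  rcases max_cases lam (s i) with ⟨h, _⟩ | ⟨h, _⟩ <;> rw [h, abs_le] <;> constructor <;> linarith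

theorem IsSVD.mulVec_norm {U V : Matrix (Fin d) (Fin d) ℝ} {s : Fin d → ℝ}
    (h : IsSVD A U s V) (i : Fin d) :
    ∃ v : EuclideanSpace ℝ (Fin d), ‖v‖ = 1 ∧ ‖Matrix.toEuclideanLin A v‖ ≤ s i := by
  have hV : Vᵀ * V = 1 := (Matrix.mem_unitaryGroup_iff').1 h.orthogonal_right
  let e : EuclideanSpace ℝ (Fin d) := EuclideanSpace.single i 1
  have he : ‖e‖ = 1 := by simp [e]
  let v : EuclideanSpace ℝ (Fin d) := WithLp.toLp 2 (V *ᵥ e.ofLp)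
  have hVle := Matrix.l2_opNorm_le_one_of_mem_orthogonalGroup h.orthogonal_right
  have hVt : ‖Vᵀ‖ ≤ 1 := by
    rw [← Matrix.conjTranspose_eq_transpose_of_trivial, Matrix.l2_opNorm_conjTranspose]
    exact hVle
  have h1 : ‖v‖ ≤ 1 := by
    have := Matrix.l2_opNorm_mulVec V e
    rw [he, mul_one] at this
    exact this.trans hVle
  have h2 : 1 ≤ ‖v‖ := by
    have := Matrix.l2_opNorm_mulVec Vᵀ v
    have hve : (WithLp.toLp 2 (Vᵀ *ᵥ v.ofLp) : EuclideanSpace ℝ (Fin d)) = e := by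
      simp [v, Matrix.mulVec_mulVec, hV]
    have h3 : ‖(WithLp.toLp 2 (Vᵀ *ᵥ v.ofLp) : EuclideanSpace ℝ (Fin d))‖ ≤ ‖Vᵀ‖ * ‖v‖ := this
    rw [hve, he] at h3
    nlinarith [norm_nonneg v]
  refine ⟨v, le_antisymm h1 h2, ?_⟩
  have hAv : Matrix.toEuclideanLin A v =
      WithLp.toLp 2 (U *ᵥ (EuclideanSpace.single i (s i)).ofLp) := by
    rw [Matrix.toLpLin_apply]
    congr 1
    show A *ᵥ (V *ᵥ e.ofLp) = _
    rw [h.eq, Matrix.mulVec_mulVec, Matrix.mul_assoc, hV, Matrix.mul_one, ← Matrix.mulVec_mulVec]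
    congr 1
    ext j
    by_cases hj : j = i <;> simp [e, Matrix.mulVec_diagonal, hj]
  have h4 : ‖(WithLp.toLp 2 (U *ᵥ (EuclideanSpace.single i (s i)).ofLp) :
      EuclideanSpace ℝ (Fin d))‖ ≤ ‖U‖ * ‖EuclideanSpace.single i (s i)‖ :=
    Matrix.l2_opNorm_mulVec U _
  have hU := Matrix.l2_opNorm_le_one_of_mem_orthogonalGroup h.orthogonal_left
  have hs := h.nonneg i
  rw [hAv]
  refine h4.trans ?_
  rw [PiLp.norm_single, Real.norm_eq_abs, abs_of_nonneg hs]
  nlinarith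

theorem IsSVD.inv_clip {U V : Matrix (Fin d) (Fin d) ℝ} {s : Fin d → ℝ}
    (h : IsSVD A U s V) {c : ℝ} (hc : 0 < c) (hs : ∀ i, c ≤ max lam (s i)) :
    IsUnit (U * Matrix.diagonal (fun i => max lam (s i)) * Vᵀ).det ∧
      ‖(U * Matrix.diagonal (fun i => max lam (s i)) * Vᵀ)⁻¹‖ ≤ c⁻¹ := by
  have hpos (i : Fin d) : 0 < max lam (s i) := hc.trans_le (hs i)
  have hV : Vᵀ * V = 1 := (Matrix.mem_unitaryGroup_iff').1 h.orthogonal_right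
  have hU : U * Uᵀ = 1 := (Matrix.mem_unitaryGroup_iff).1 h.orthogonal_left
  have hinv : U * Matrix.diagonal (fun i => max lam (s i)) * Vᵀ *
      (V * Matrix.diagonal (fun i => (max lam (s i))⁻¹) * Uᵀ) = 1 := by
    have hD : Matrix.diagonal (fun i => max lam (s i)) *
        Matrix.diagonal (fun i => (max lam (s i))⁻¹) = 1 := by
      rw [Matrix.diagonal_mul_diagonal, ← Matrix.diagonal_one]
      congr 1
      funext i
      exact mul_inv_cancel₀ (hpos i).ne'
    calc _ = U * (Matrix.diagonal (fun i => max lam (s i)) * ((Vᵀ * V) *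
        Matrix.diagonal (fun i => (max lam (s i))⁻¹))) * Uᵀ := by simp only [Matrix.mul_assoc]
      _ = 1 := by rw [hV, Matrix.one_mul, hD, Matrix.mul_one, hU]
  refine ⟨Matrix.isUnit_det_of_right_inverse hinv, ?_⟩
  rw [Matrix.inv_eq_right_inv hinv]
  refine Matrix.l2_opNorm_orthogonal_mul_diagonal_mul_le h.orthogonal_right h.orthogonal_left
    (by positivity) fun i => ?_
  rw [abs_of_pos (inv_pos.2 (hpos i))]
  exact inv_anti₀ hc (hs i)

theorem IsSingularValueClip.inv (hlam : 0 < lam) (h : IsSingularValueClip lam A S) :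
    IsUnit S.det ∧ ‖S⁻¹‖ ≤ lam⁻¹ := by
  obtain ⟨U, s, V, hsvd, rfl⟩ := h
  exact hsvd.inv_clip hlam fun i => le_max_left _ _

/-- The inverse of the clipped matrix is well conditioned near a well conditioned matrix. -/
theorem IsSingularValueClip.norm_inv_le_of_close (h : IsSingularValueClip lam A S)
    {B : Matrix (Fin d) (Fin d) ℝ} {c : ℝ} (hc : 0 < c) (hB : c + ‖A - B‖ ≤ sigmaMin B) :
    ‖S⁻¹‖ ≤ c⁻¹ := by
  obtain ⟨U, s, V, hsvd, rfl⟩ := h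
  refine (hsvd.inv_clip hc fun i => le_max_of_le_right ?_).2
  obtain ⟨v, hv, hAv⟩ := hsvd.mulVec_norm i
  have h1 := sigmaMin_mul_norm_le B v
  have h2 : ‖Matrix.toEuclideanLin (A - B) v‖ ≤ ‖A - B‖ * ‖v‖ := Matrix.l2_opNorm_mulVec _ v
  have h3 : Matrix.toEuclideanLin B v =
      Matrix.toEuclideanLin A v - Matrix.toEuclideanLin (A - B) v := by simp
  have h4 := _root_.norm_sub_le (Matrix.toEuclideanLin A v) (Matrix.toEuclideanLin (A - B) v)
  rw [← h3] at h4
  rw [hv, mul_one] at h1 h2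
  linarith

/-- Deterministic error decomposition for the clipped instrumental variable estimator. -/
theorem IsSingularValueClip.norm_estimator_sub_le {l : ℕ} (hlam : 0 < lam)
    (h : IsSingularValueClip lam A S) (B θ : Matrix (Fin d) (Fin l) ℝ) :
    ‖S⁻¹ * B - θ‖ ≤ ‖S⁻¹‖ * (lam * ‖θ‖) + ‖S⁻¹‖ * ‖B - A * θ‖ := by
  have hdet := (h.inv hlam).1
  have heq : S⁻¹ * B - θ = S⁻¹ * ((A - S) * θ) + S⁻¹ * (B - A * θ) := by
    rw [Matrix.sub_mul, Matrix.mul_sub, Matrix.mul_sub, ← Matrix.mul_assoc S⁻¹ S,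
      Matrix.nonsing_inv_mul _ hdet, Matrix.one_mul]
    abel
  rw [heq]
  refine (norm_add_le _ _).trans (add_le_add ?_ (Matrix.l2_opNorm_mul _ _))
  refine (Matrix.l2_opNorm_mul _ _).trans ?_
  gcongr
  refine (Matrix.l2_opNorm_mul _ _).trans ?_
  gcongr
  exact h.norm_sub_le hlam.le

end SingularValueClip

section ErrorBound

variable {Ω : Type*} [MeasurableSpace Ω] {μ : Measure Ω}

theorem eLpNorm_mul_le_of_two_mul {f g : Ω → ℝ} (hf : AEStronglyMeasurable f μ)
    (hg : AEStronglyMeasurable g μ) {q : ℝ} (hq : 0 < q) :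
    eLpNorm (fun ω => f ω * g ω) (ENNReal.ofReal q) μ ≤
      eLpNorm f (ENNReal.ofReal (2 * q)) μ * eLpNorm g (ENNReal.ofReal (2 * q)) μ := by
  have : ENNReal.HolderTriple (ENNReal.ofReal (2 * q)) (ENNReal.ofReal (2 * q))
      (ENNReal.ofReal q) := ⟨by
    rw [← ENNReal.ofReal_inv_of_pos (by positivity), ← ENNReal.ofReal_inv_of_pos (by positivity),
      ← ENNReal.ofReal_add (by positivity) (by positivity)]
    congr 1
    field_simp
    norm_num⟩
  have h := eLpNorm_smul_le_mul_eLpNorm (μ := μ) (f := g) (φ := f) (r := ENNReal.ofReal q)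
    (p := ENNReal.ofReal (2 * q)) (q := ENNReal.ofReal (2 * q)) hg hf
  have hfun : f • g = fun ω => f ω * g ω := rfl
  rwa [hfun] at h

variable [IsProbabilityMeasure μ]

theorem eLpNorm_sum_abs_le {k l : ℕ} {T : Fin k → Fin l → Ω → ℝ} {c : ℝ≥0}
    (h : ∀ a b, HasSubgaussianMGF (T a b) c μ) {p : ℝ} (hp : 1 ≤ p) :
    eLpNorm (fun ω => ∑ a, ∑ b, |T a b ω|) (ENNReal.ofReal p) μ ≤
      ENNReal.ofReal (k * l * (4 * √(p * c))) := by
  have hp' : 1 ≤ ENNReal.ofReal p := by simpa using hp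
  have hm (a : Fin k) (b : Fin l) : AEStronglyMeasurable (fun ω => |T a b ω|) μ :=
    (h a b).aestronglyMeasurable.norm
  have hfun : (fun ω => ∑ a, ∑ b, |T a b ω|) =
      ∑ ab : Fin k × Fin l, fun ω => |T ab.1 ab.2 ω| := by
    funext ω
    rw [Finset.sum_apply, Fintype.sum_prod_type]
  rw [hfun]
  refine (eLpNorm_sum_le (fun ab _ => hm ab.1 ab.2) hp').trans ?_
  calc ∑ ab : Fin k × Fin l, eLpNorm (fun ω => |T ab.1 ab.2 ω|) (ENNReal.ofReal p) μ
      ≤ ∑ _ab : Fin k × Fin l, ENNReal.ofReal (4 * √(p * c)) := by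
        refine Finset.sum_le_sum fun ab _ => ?_
        have := (h ab.1 ab.2).eLpNorm_le hp
        rwa [← eLpNorm_norm] at this
    _ = ENNReal.ofReal (k * l * (4 * √(p * c))) := by
        rw [← Nat.cast_mul, ENNReal.ofReal_mul (Nat.cast_nonneg _), ENNReal.ofReal_natCast]
        simp

theorem measure_sum_abs_gt_le {k l : ℕ} {T : Fin k → Fin l → Ω → ℝ} {c : ℝ≥0}
    (h : ∀ a b, HasSubgaussianMGF (T a b) c μ) {D : ℝ} (hD : 0 < D) (hkl : (k * l : ℝ) ≤ D)
    {t : ℝ} (ht : 0 ≤ t) :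
    μ.real {ω | t < ∑ a, ∑ b, |T a b ω|} ≤ 2 * D * Real.exp (-(t / D) ^ 2 / (2 * c)) := by
  have hsub : {ω | t < ∑ a, ∑ b, |T a b ω|} ⊆
      ⋃ ab ∈ (Finset.univ : Finset (Fin k × Fin l)), {ω | t / D ≤ |T ab.1 ab.2 ω|} := by
    intro ω hω
    by_contra hcon
    simp only [Finset.mem_univ, Set.iUnion_true, Set.mem_iUnion, Set.mem_ofPred_eq, not_exists,
      not_le] at hcon
    have : ∑ a, ∑ b, |T a b ω| ≤ k * l * (t / D) := by
      refine (Finset.sum_le_sum fun a _ => Finset.sum_le_sum fun b _ =>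
        (hcon (a, b)).le).trans_eq ?_
      simp [mul_assoc]
    have h2 : k * l * (t / D) ≤ D * (t / D) := by gcongr
    rw [mul_div_cancel₀ _ hD.ne'] at h2
    exact absurd (show t < _ from hω) (by linarith)
  calc μ.real {ω | t < ∑ a, ∑ b, |T a b ω|}
      ≤ ∑ ab : Fin k × Fin l, μ.real {ω | t / D ≤ |T ab.1 ab.2 ω|} :=
        (measureReal_mono hsub (measure_ne_top _ _)).trans (measureReal_biUnion_finset_le _ _)
    _ ≤ ∑ _ab : Fin k × Fin l, 2 * Real.exp (-(t / D) ^ 2 / (2 * c)) :=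
        Finset.sum_le_sum fun ab _ => (h ab.1 ab.2).measure_abs_ge_le (by positivity)
    _ = k * l * (2 * Real.exp (-(t / D) ^ 2 / (2 * c))) := by simp
    _ ≤ D * (2 * Real.exp (-(t / D) ^ 2 / (2 * c))) := by gcongr
    _ = _ := by ring

theorem eLpNorm_const_add_indicator_le {B : Set Ω} (hB : MeasurableSet B) {u v p P : ℝ}
    (hu : 0 ≤ u) (hv : 0 ≤ v) (hp : 1 ≤ p) (hP : μ.real B ≤ P) :
    eLpNorm (fun ω => u + B.indicator (fun _ => v) ω) (ENNReal.ofReal p) μ ≤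
      ENNReal.ofReal (u + v * P ^ (1 / p)) := by
  have hp0 : 0 < p := by linarith
  have hp' : 1 ≤ ENNReal.ofReal p := by simpa using hp
  have hP0 : 0 ≤ P := measureReal_nonneg.trans hP
  have h1 : eLpNorm (fun _ : Ω => u) (ENNReal.ofReal p) μ = ENNReal.ofReal u := by
    rw [eLpNorm_const' _ (by simpa using hp0) (by simp)]
    simp [Real.enorm_eq_ofReal hu]
  have h2 : eLpNorm (B.indicator fun _ => v) (ENNReal.ofReal p) μ ≤
      ENNReal.ofReal (v * P ^ (1 / p)) := by
    rw [eLpNorm_indicator_const hB (by simpa using hp0) (by simp), Real.enorm_eq_ofReal hv,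
      ENNReal.ofReal_mul hv, ENNReal.toReal_ofReal hp0.le,
      ← ENNReal.ofReal_rpow_of_nonneg hP0 (by positivity)]
    gcongr
    rw [← ofReal_measureReal]
    exact ENNReal.ofReal_le_ofReal hP
  refine (eLpNorm_add_le aestronglyMeasurable_const
    (aestronglyMeasurable_const.indicator hB) hp').trans ?_
  rw [ENNReal.ofReal_add hu (by positivity), h1]
  gcongr

theorem two_div_add_gammaTail_le_gammaFun {C₁ C₂ C₃ r a b K : ℝ} (hC₁ : 0 ≤ C₁) (hr : 0 ≤ r)
    (hb : 0 ≤ b) (hK : 0 ≤ K) :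
    2 / b + gammaTail C₃ r a b K ≤ gammaFun C₁ C₂ C₃ r a b K := by
  have : 0 ≤ gammaBody C₁ C₂ r a b K := by unfold gammaBody; positivity
  unfold gammaFun gammaHead
  linarith

theorem gammaTail_nonneg {C₃ r a b K : ℝ} (ha : 0 ≤ a) : 0 ≤ gammaTail C₃ r a b K := by
  unfold gammaTail
  split_ifs <;> positivity

theorem rpow_tail_bound_eq {D s p : ℝ} (hD : 0 ≤ D) :
    (D * Real.exp (-s)) ^ (1 / p) = D ^ (1 / p) * Real.exp (-(s / p)) := by
  rw [Real.mul_rpow hD (by positivity), ← Real.exp_mul]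
  congr 2
  ring

/-- Tail contribution in the regime where the dimensional prefactor is absorbed. -/
theorem tail_le_gammaTail_of_large {D a b K q P : ℝ} (hD : 1 ≤ D) (ha : 0 < a) (hq : 0 < q)
    (hK : 0 < K) (hlarge : 8 * D ^ 3 * K ≤ b) (hP0 : 0 ≤ P)
    (hP : P ≤ 2 * D ^ 2 * Real.exp (-(b ^ 2 / (16 * D ^ 4 * K ^ 2)))) :
    1 / a * P ^ (1 / q) ≤ gammaTail (1 / (32 * D ^ 4)) q a b K := by
  have hDpos : 0 < D := by linarith
  set s := b ^ 2 / (32 * D ^ 4 * K ^ 2) with hs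
  have hs2 : 2 * D ^ 2 ≤ s := by
    rw [hs, le_div_iff₀ (by positivity)]
    calc 2 * D ^ 2 * (32 * D ^ 4 * K ^ 2) = (8 * D ^ 3 * K) ^ 2 := by ring
      _ ≤ b ^ 2 := by gcongr
  have hss : b ^ 2 / (16 * D ^ 4 * K ^ 2) = s + s := by rw [hs]; field_simp; ring
  have hPs : P ≤ Real.exp (-s) := by
    refine hP.trans ?_
    rw [hss, neg_add, Real.exp_add, ← mul_assoc]
    refine mul_le_of_le_one_left (by positivity) ?_
    rw [Real.exp_neg, ← div_eq_mul_inv, div_le_one (by positivity)]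
    linarith [Real.add_one_le_exp s]
  rw [gammaTail, if_neg hK.ne', one_div_mul_eq_div]
  gcongr
  calc P ^ (1 / q) ≤ Real.exp (-s) ^ (1 / q) := by gcongr
    _ = Real.exp (-(1 / (32 * D ^ 4) * b ^ 2 / (q * K ^ 2))) := by
      rw [← Real.exp_mul, hs]
      congr 1
      field_simp

/-- Tail contribution at twice the moment order, up to a dimensional factor. -/
theorem tail_le_mul_gammaTail {D a b K q r P : ℝ} (hD : 1 ≤ D) (ha : 0 < a) (hq : 1 ≤ q)
    (hqr : q ≤ r) (hK : 0 < K) (hP0 : 0 ≤ P)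
    (hP : P ≤ 2 * D ^ 2 * Real.exp (-(b ^ 2 / (16 * D ^ 4 * K ^ 2)))) :
    1 / a * P ^ (1 / (2 * q)) ≤ 2 * D ^ 2 * gammaTail (1 / (32 * D ^ 4)) r a b K := by
  have hDpos : 0 < D := by linarith
  have hqpos : 0 < q := by linarith
  have hrpos : 0 < r := by linarith
  have hD2 : 1 ≤ 2 * D ^ 2 := by nlinarith
  have h1 : (2 * D ^ 2) ^ (1 / (2 * q)) ≤ 2 * D ^ 2 :=
    Real.rpow_le_self_of_one_le hD2 (by rw [div_le_one (by positivity)]; linarith)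
  rw [gammaTail, if_neg hK.ne', one_div_mul_eq_div, ← mul_div_assoc]
  gcongr
  calc P ^ (1 / (2 * q))
      ≤ (2 * D ^ 2 * Real.exp (-(b ^ 2 / (16 * D ^ 4 * K ^ 2)))) ^ (1 / (2 * q)) := by gcongr
    _ = (2 * D ^ 2) ^ (1 / (2 * q)) * Real.exp (-(b ^ 2 / (16 * D ^ 4 * K ^ 2) / (2 * q))) :=
      rpow_tail_bound_eq (by positivity)
    _ ≤ 2 * D ^ 2 * Real.exp (-(1 / (32 * D ^ 4) * b ^ 2 / (r * K ^ 2))) := by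
      have h2 : b ^ 2 / (16 * D ^ 4 * K ^ 2) / (2 * q) =
          1 / (32 * D ^ 4) * b ^ 2 / (q * K ^ 2) := by field_simp; ring
      rw [h2]
      gcongr

/-- The resolvent bound: moments of the majorant `2 / b + 1_B / a` of the inverse of the clipped
matrix, where `B` is the event that the fluctuations are larger than `b / 2`. -/
theorem eLpNorm_majorant_le {k : ℕ} {T : Fin k → Fin k → Ω → ℝ} (hT : ∀ i j, Measurable (T i j))
    {c : ℝ≥0} (h : ∀ i j, HasSubgaussianMGF (T i j) c μ) {K D a b : ℝ} (hK : 0 ≤ K)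
    (hc : (c : ℝ) = 2 * K ^ 2) (hD : 1 ≤ D) (hkD : (k * k : ℝ) ≤ D ^ 2) (ha : 0 < a)
    (hb : 0 < b) {q r : ℝ} (hq : 1 ≤ q) (hqr : q ≤ r) :
    let G : Ω → ℝ := fun ω => 2 / b +
      {ω | b / 2 < ∑ i, ∑ j, |T i j ω|}.indicator (fun _ => 1 / a) ω
    (8 * D ^ 3 * K ≤ b → eLpNorm G (ENNReal.ofReal q) μ ≤
      ENNReal.ofReal (2 / b + gammaTail (1 / (32 * D ^ 4)) q a b K)) ∧
    eLpNorm G (ENNReal.ofReal (2 * q)) μ ≤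
      ENNReal.ofReal (2 * D ^ 2 * (2 / b + gammaTail (1 / (32 * D ^ 4)) r a b K)) := by
  intro G
  have hDpos : 0 < D := by linarith
  have hD2 : 1 ≤ 2 * D ^ 2 := by nlinarith
  have hB : MeasurableSet {ω | b / 2 < ∑ i, ∑ j, |T i j ω|} := by
    refine measurableSet_lt measurable_const ?_
    exact Finset.measurable_sum _ fun i _ => Finset.measurable_sum _ fun j _ => (hT i j).abs
  have hG (p : ℝ) (hp : 1 ≤ p) := eLpNorm_const_add_indicator_le (μ := μ) hB
    (u := 2 / b) (v := 1 / a) (by positivity) (by positivity) hp le_rfl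
  have hq2 : 1 ≤ 2 * q := by linarith
  have h2b : 2 / b ≤ 2 * D ^ 2 * (2 / b) := le_mul_of_one_le_left (by positivity) hD2
  rcases hK.eq_or_lt with rfl | hKpos
  · have hc0 : c = 0 := by
      rw [← NNReal.coe_eq_zero, hc]; simp
    subst hc0
    have hzero : μ.real {ω | b / 2 < ∑ i, ∑ j, |T i j ω|} = 0 := by
      have hae : ∀ᵐ ω ∂μ, ∀ i j, T i j ω = 0 := by
        rw [ae_all_iff]; intro i
        rw [ae_all_iff]; intro j
        exact (h i j).ae_eq_zero_of_hasSubgaussianMGF_zero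
      rw [measureReal_eq_zero_iff, measure_eq_zero_iff_ae_notMem]
      filter_upwards [hae] with ω hω
      simp only [hω, abs_zero, Finset.sum_const_zero, not_lt]
      positivity
    refine ⟨fun _ => (hG q hq).trans (ENNReal.ofReal_le_ofReal ?_),
      (hG (2 * q) hq2).trans (ENNReal.ofReal_le_ofReal ?_)⟩
    · rw [hzero, Real.zero_rpow (by positivity), gammaTail, if_pos rfl]; simp
    · rw [hzero, Real.zero_rpow (by positivity), gammaTail, if_pos rfl]
      simpa using h2b
  · have hP := measure_sum_abs_gt_le h (by positivity : 0 < D ^ 2) hkD (t := b / 2)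
      (by positivity)
    have hexp : -(b / 2 / D ^ 2) ^ 2 / (2 * (c : ℝ)) = -(b ^ 2 / (16 * D ^ 4 * K ^ 2)) := by
      rw [hc]; field_simp; ring
    rw [hexp] at hP
    refine ⟨fun hl => (hG q hq).trans (ENNReal.ofReal_le_ofReal ?_),
      (hG (2 * q) hq2).trans (ENNReal.ofReal_le_ofReal ?_)⟩
    · gcongr
      exact tail_le_gammaTail_of_large hD ha (by linarith) hKpos hl measureReal_nonneg hP
    · rw [mul_add]
      exact add_le_add h2b (tail_le_mul_gammaTail hD ha hq hqr hKpos measureReal_nonneg hP)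

theorem eLpNorm_const_add_add_mul_le {U V : Ω → ℝ} (hU : AEStronglyMeasurable U μ)
    (hV : AEStronglyMeasurable V μ) {β τ u v p : ℝ} (hβ : 0 ≤ β) (hτ : 0 ≤ τ) (hu : 0 ≤ u)
    (hv : 0 ≤ v) (hp : 1 ≤ p) (hUle : eLpNorm U (ENNReal.ofReal p) μ ≤ ENNReal.ofReal u)
    (hVle : eLpNorm V (ENNReal.ofReal p) μ ≤ ENNReal.ofReal v) :
    eLpNorm (fun ω => β + (V ω + τ * U ω)) (ENNReal.ofReal p) μ ≤
      ENNReal.ofReal (β + (v + τ * u)) := by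
  have hp' : 1 ≤ ENNReal.ofReal p := by simpa using hp
  have hp0 : 0 < p := by linarith
  have h1 : eLpNorm (fun _ : Ω => β) (ENNReal.ofReal p) μ = ENNReal.ofReal β := by
    rw [eLpNorm_const' _ (by simpa using hp0) (by simp)]
    simp [Real.enorm_eq_ofReal hβ]
  have h2 : eLpNorm (fun ω => τ * U ω) (ENNReal.ofReal p) μ ≤ ENNReal.ofReal (τ * u) := by
    refine (eLpNorm_const_smul_le (c := τ) (f := U)).trans ?_
    rw [Real.enorm_eq_ofReal hτ, ENNReal.ofReal_mul hτ]
    gcongr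
  rw [ENNReal.ofReal_add hβ (by positivity), ENNReal.ofReal_add hv (by positivity)]
  refine (eLpNorm_add_le aestronglyMeasurable_const (hV.add (hU.const_mul τ)) hp').trans ?_
  refine add_le_add h1.le ((eLpNorm_add_le hV (hU.const_mul τ) hp').trans ?_)
  exact add_le_add hVle h2

end ErrorBound

theorem lag_scale_eq {n N : ℕ} (ν : ℝ≥0) :
    (((n : ℝ≥0) * N * (2 * ν ^ 2) : ℝ≥0) : ℝ) = 2 * (√(n * N : ℝ) * ν) ^ 2 := by
  rw [mul_pow, Real.sq_sqrt (by positivity)]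
  push_cast
  ring

theorem sum_moment_scale_le {k l : ℕ} {D q K : ℝ} {c : ℝ≥0} (hkl : (k * l : ℝ) ≤ D ^ 2)
    (hK : 0 ≤ K) (hq : 0 ≤ q) (hc : (c : ℝ) = 2 * K ^ 2) :
    k * l * (4 * √(2 * q * c)) ≤ 8 * D ^ 2 * √q * K := by
  have h : √(2 * q * c) = 2 * √q * K := by
    rw [hc, show 2 * q * (2 * K ^ 2) = q * (2 * K) ^ 2 by ring, Real.sqrt_mul hq,
      Real.sqrt_sq (by positivity)]
    ring
  rw [h]
  calc k * l * (4 * (2 * √q * K)) ≤ D ^ 2 * (4 * (2 * √q * K)) := by gcongr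
    _ = _ := by ring

set_option maxHeartbeats 400000 in
theorem theorem1 (dx dy : ℕ) :
    ∃ C C₁ C₂ C₃ : ℝ, 0 < C ∧ 0 < C₁ ∧ 0 < C₂ ∧ 0 < C₃ ∧
    ∀ {Ω : Type*} [MeasurableSpace Ω] (μ : Measure Ω) [IsProbabilityMeasure μ]
      (n N : ℕ) (_hN : 1 ≤ N)
      (lam q ε σ : ℝ) (_hlam : 0 < lam) (_hq : 2 ≤ q) (_hε : 0 < ε)
      (_hσ : 0 < σ ^ 2) (_hlamσ : lam < σ ^ 2)
      -- the latent regression model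
      (Ystar : Matrix (Fin n) (Fin dy) ℝ) (Xstar : Matrix (Fin n) (Fin dx) ℝ)
      (θstar : Matrix (Fin dx) (Fin dy) ℝ) (_hθ : θstar ≠ 0)
      (_hmodel : Ystar = Xstar * θstar)
      -- the data
      (z x : Fin n → Ω → Fin dx → ℝ) (y : Fin n → Ω → Fin dy → ℝ)
      (_hz : ∀ i, Measurable (z i)) (_hx : ∀ i, Measurable (x i)) (_hy : ∀ i, Measurable (y i))
      (_hzint : ∀ i, Integrable (z i) μ)
      -- bias and centered sub-gaussian bounds
      (νbar_zy νbar_zx νtil_zy νtil_zx : ℝ≥0)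
      (_hbzy : ∀ i, ‖matrixExpectation μ (fun ω =>
        Matrix.vecMulVec (z i ω) (y i ω) - Matrix.vecMulVec (z i ω) (Ystar i))‖ ≤ νbar_zy)
      (_hbzx : ∀ i, ‖matrixExpectation μ (fun ω =>
        Matrix.vecMulVec (z i ω) (x i ω) - Matrix.vecMulVec (z i ω) (Xstar i))‖ ≤ νbar_zx)
      (_htzy : ∀ i, centeredSubgaussianNorm μ
        (fun ω => Matrix.vecMulVec (z i ω) (y i ω)) ≤ νtil_zy)
      (_htzx : ∀ i, centeredSubgaussianNorm μ
        (fun ω => Matrix.vecMulVec (z i ω) (x i ω)) ≤ νtil_zx)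
      -- independence at lag `N` or more
      (_hindep : ∀ I : Finset (Fin n),
        (∀ i ∈ I, ∀ j ∈ I, i ≠ j → (N : ℤ) ≤ |((i : ℕ) : ℤ) - ((j : ℕ) : ℤ)|) →
        iIndepFun (fun (i : I) ω => (x i ω, y i ω, z i ω)) μ)
      -- the data matrices, with rows `z i`, `x i`, `y i`
      (Z X : Ω → Matrix (Fin n) (Fin dx) ℝ) (Y : Ω → Matrix (Fin n) (Fin dy) ℝ)
      (_hZ : ∀ ω i, Z ω i = z i ω) (_hX : ∀ ω i, X ω i = x i ω) (_hY : ∀ ω i, Y ω i = y i ω)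
      -- persistence of excitation
      (_hpe : σ ^ 2 ≤ sigmaMin (matrixExpectation μ fun ω => (Z ω)ᵀ * X ω))
      -- the estimator
      (S : Ω → Matrix (Fin dx) (Fin dx) ℝ)
      (_hS : ∀ ω, IsSingularValueClip lam ((Z ω)ᵀ * X ω) (S ω))
      (θhat : Ω → Matrix (Fin dx) (Fin dy) ℝ)
      (_hθhat : ∀ ω, θhat ω = (S ω)⁻¹ * ((Z ω)ᵀ * Y ω)),
      eLpNorm (fun ω => θhat ω - θstar) (ENNReal.ofReal q) μ / ENNReal.ofReal ‖θstar‖ ≤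
        ENNReal.ofReal
          (gammaFun C₁ C₂ C₃ q lam (σ ^ 2 - lam) (√(n * N : ℝ) * νtil_zx) * lam
            + C * √(q * (1 + 1 / ε))
              * gammaFun C₁ C₂ C₃ (q * (1 + 1 / ε)) lam (σ ^ 2 - lam) (√(n * N : ℝ) * νtil_zx)
              * (n * (νbar_zx + ‖θstar‖⁻¹ * νbar_zy)
                + √(n * N : ℝ) * (νtil_zx + ‖θstar‖⁻¹ * νtil_zy))) := by
  set D : ℝ := dx + dy + 1 with hDdef
  have hdx : (0 : ℝ) ≤ dx := Nat.cast_nonneg dx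
  have hdy : (0 : ℝ) ≤ dy := Nat.cast_nonneg dy
  have hD : 1 ≤ D := by rw [hDdef]; linarith
  have hDpos : 0 < D := by linarith
  have hxx : (dx * dx : ℝ) ≤ D ^ 2 := by
    rw [sq, hDdef]; gcongr <;> linarith
  have hxy : (dx * dy : ℝ) ≤ D ^ 2 := by
    rw [sq, hDdef]; gcongr <;> linarith
  refine ⟨16 * D ^ 4 + 4 * D ^ 3, 1, 1, 1 / (32 * D ^ 4), by positivity, one_pos, one_pos,
    by positivity, ?_⟩
  intro Ω _ μ _ n N hN lam q ε σ hlam hq hε _ hlamσ Ystar Xstar θstar hθ hmodel z x y hz hx hy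
    hzint νbar_zy νbar_zx νtil_zy νtil_zx hbzy hbzx htzy htzx hindep Z X Y hZ hX hY hpe S hS
    θhat hθhat
  set b : ℝ := σ ^ 2 - lam with hb_def
  have hb : 0 < b := by rw [hb_def]; linarith
  set K : ℝ := √(n * N : ℝ) * νtil_zx with hK_def
  have hK : 0 ≤ K := by positivity
  set r : ℝ := q * (1 + 1 / ε) with hr_def
  have hqr : q ≤ r := by
    rw [hr_def]
    exact le_mul_of_one_le_right (by linarith) (by linarith [one_div_pos.2 hε])
  have hq1 : 1 ≤ q := by linarith
  have hr1 : 1 ≤ √r := Real.one_le_sqrt.2 (by linarith)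
  have hτ : 0 < ‖θstar‖ := norm_pos_iff.2 hθ
  set τ : ℝ := ‖θstar‖ with hτ_def
  set K' : ℝ := √(n * N : ℝ) * νtil_zy with hK'_def
  have hK' : 0 ≤ K' := by positivity
  set Q : ℝ := n * (νbar_zx + τ⁻¹ * νbar_zy) + √(n * N : ℝ) * (νtil_zx + τ⁻¹ * νtil_zy) with hQ_def
  have hQK : K ≤ Q := by
    have : 0 ≤ n * (νbar_zx + τ⁻¹ * νbar_zy) + √(n * N : ℝ) * (τ⁻¹ * νtil_zy) := by positivity
    rw [hQ_def, hK_def]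
    linarith
  have hQ0 : 0 ≤ Q := hK.trans hQK
  have hτQ : τ * Q = n * (νbar_zx * τ + νbar_zy) + (K' + τ * K) := by
    rw [hQ_def, hK_def, hK'_def]
    field_simp
    ring
  set γq : ℝ := gammaFun 1 1 (1 / (32 * D ^ 4)) q lam b K with hγq_def
  set γr : ℝ := gammaFun 1 1 (1 / (32 * D ^ 4)) r lam b K with hγr_def
  have hγq : 2 / b + gammaTail (1 / (32 * D ^ 4)) q lam b K ≤ γq :=
    two_div_add_gammaTail_le_gammaFun zero_le_one (by linarith) hb.le hK
  have hγr : 2 / b + gammaTail (1 / (32 * D ^ 4)) r lam b K ≤ γr :=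
    two_div_add_gammaTail_le_gammaFun zero_le_one (by linarith) hb.le hK
  have h2b : 0 < 2 / b := by positivity
  have htq := gammaTail_nonneg (C₃ := 1 / (32 * D ^ 4)) (r := q) (b := b) (K := K) hlam.le
  have htr := gammaTail_nonneg (C₃ := 1 / (32 * D ^ 4)) (r := r) (b := b) (K := K) hlam.le
  have hγq0 : 0 < γq := by linarith
  have hγr0 : 0 < γr := by linarith
  -- fluctuations of the empirical cross-moments
  set EA := matrixExpectation μ (fun ω => (Z ω)ᵀ * X ω) with hEA
  set EB := matrixExpectation μ (fun ω => (Z ω)ᵀ * Y ω) with hEB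
  let T : Fin dx → Fin dx → Ω → ℝ := fun i j ω => ((Z ω)ᵀ * X ω - EA) i j
  let F : Fin dx → Fin dy → Ω → ℝ := fun i j ω => ((Z ω)ᵀ * Y ω - EB) i j
  have hTsub (i j : Fin dx) : HasSubgaussianMGF (T i j) (n * N * (2 * νtil_zx ^ 2)) μ :=
    crossMoment_entry_subgaussian hN hz hx htzx (fun I hI => (hindep I hI).comp
      (fun _ (p : (Fin dx → ℝ) × (Fin dy → ℝ) × (Fin dx → ℝ)) => (p.2.2, p.1))
      fun _ => by fun_prop) hZ hX i j
  have hFsub (i : Fin dx) (j : Fin dy) :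
      HasSubgaussianMGF (F i j) (n * N * (2 * νtil_zy ^ 2)) μ :=
    crossMoment_entry_subgaussian hN hz hy htzy (fun I hI => (hindep I hI).comp
      (fun _ (p : (Fin dx → ℝ) × (Fin dy → ℝ) × (Fin dx → ℝ)) => (p.2.2, p.2.1))
      fun _ => by fun_prop) hZ hY i j
  have hTmeas (i j : Fin dx) : Measurable (T i j) := by
    simp only [T, Matrix.sub_apply, Matrix.mul_apply, Matrix.transpose_apply, hZ, hX]
    fun_prop
  let U : Ω → ℝ := fun ω => ∑ i, ∑ j, |T i j ω|
  let V : Ω → ℝ := fun ω => ∑ i, ∑ j, |F i j ω|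
  have hUmeas : Measurable U :=
    Finset.measurable_sum _ fun i _ => Finset.measurable_sum _ fun j _ => (hTmeas i j).abs
  have hVmeas : AEStronglyMeasurable V μ := by
    refine Finset.aestronglyMeasurable_fun_sum _ fun i _ =>
      Finset.aestronglyMeasurable_fun_sum _ fun j _ => ?_
    exact (hFsub i j).aestronglyMeasurable.norm
  have hq2 : 1 ≤ 2 * q := by linarith
  have hU : eLpNorm U (ENNReal.ofReal (2 * q)) μ ≤ ENNReal.ofReal (8 * D ^ 2 * √q * K) :=
    (eLpNorm_sum_abs_le hTsub hq2).trans (ENNReal.ofReal_le_ofReal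
      (sum_moment_scale_le hxx hK (by linarith) (lag_scale_eq νtil_zx)))
  have hV : eLpNorm V (ENNReal.ofReal (2 * q)) μ ≤ ENNReal.ofReal (8 * D ^ 2 * √q * K') :=
    (eLpNorm_sum_abs_le hFsub hq2).trans (ENNReal.ofReal_le_ofReal
      (sum_moment_scale_le hxy hK' (by linarith) (lag_scale_eq νtil_zy)))
  -- the noise term
  set β : ℝ := n * (νbar_zx * τ + νbar_zy) with hβ_def
  have hβ : 0 ≤ β := by positivity
  have hbias : ‖EB - EA * θstar‖ ≤ β := by
    have hzx (i : Fin n) (a b : Fin dx) :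
        Integrable (fun ω => Matrix.vecMulVec (z i ω) (x i ω) a b) μ :=
      (entry_subgaussian (fun a b => by simp only [Matrix.vecMulVec_apply]; fun_prop)
        (htzx i) a b).1
    have hzy (i : Fin n) (a : Fin dx) (b : Fin dy) :
        Integrable (fun ω => Matrix.vecMulVec (z i ω) (y i ω) a b) μ :=
      (entry_subgaussian (fun a b => by simp only [Matrix.vecMulVec_apply]; fun_prop)
        (htzy i) a b).1
    rw [hEA, hEB, matrixExpectation_transpose_mul hZ hX hzx,
      matrixExpectation_transpose_mul hZ hY hzy]
    exact bias_norm_le hzint hzx hzy hmodel hbzy hbzx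
  let R : Ω → ℝ := fun ω => β + (V ω + τ * U ω)
  have hRmeas : AEStronglyMeasurable R μ :=
    aestronglyMeasurable_const.add (hVmeas.add (hUmeas.aestronglyMeasurable.const_mul τ))
  have hTU (ω : Ω) : ‖(Z ω)ᵀ * X ω - EA‖ ≤ U ω := Matrix.l2_opNorm_le_sum_abs _
  have hnoise (ω : Ω) : ‖(Z ω)ᵀ * Y ω - (Z ω)ᵀ * X ω * θstar‖ ≤ R ω := by
    have heq : (Z ω)ᵀ * Y ω - (Z ω)ᵀ * X ω * θstar = (EB - EA * θstar) +
        (((Z ω)ᵀ * Y ω - EB) - ((Z ω)ᵀ * X ω - EA) * θstar) := by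
      rw [Matrix.sub_mul]; abel
    rw [heq]
    refine (norm_add_le _ _).trans (add_le_add hbias ((norm_sub_le _ _).trans
      (add_le_add (Matrix.l2_opNorm_le_sum_abs _) ((Matrix.l2_opNorm_mul _ _).trans ?_))))
    rw [mul_comm]
    gcongr
    exact hTU ω
  have hR : eLpNorm R (ENNReal.ofReal (2 * q)) μ ≤ ENNReal.ofReal (8 * D ^ 2 * √r * (τ * Q)) := by
    refine (eLpNorm_const_add_add_mul_le hUmeas.aestronglyMeasurable hVmeas hβ hτ.le
      (by positivity) (by positivity) hq2 hU hV).trans (ENNReal.ofReal_le_ofReal ?_)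
    have h1 : β ≤ 8 * D ^ 2 * √r * β := by
      refine le_mul_of_one_le_left hβ ?_
      have hD2 : 1 ≤ 8 * D ^ 2 := by linarith [one_le_pow₀ (n := 2) hD]
      exact one_le_mul_of_one_le_of_one_le hD2 hr1
    have h2 : 8 * D ^ 2 * √q * (K' + τ * K) ≤ 8 * D ^ 2 * √r * (K' + τ * K) := by gcongr
    rw [hτQ]
    linarith
  -- the inverse of the clipped matrix
  let B : Set Ω := {ω | b / 2 < U ω}
  have hBmeas : MeasurableSet B := measurableSet_lt measurable_const hUmeas
  let G : Ω → ℝ := fun ω => 2 / b + B.indicator (fun _ => 1 / lam) ω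
  have hGmeas : AEStronglyMeasurable G μ :=
    aestronglyMeasurable_const.add (aestronglyMeasurable_const.indicator hBmeas)
  obtain ⟨hG1, hG2⟩ := eLpNorm_majorant_le hTmeas hTsub hK (lag_scale_eq νtil_zx) hD hxx hlam hb
    hq1 hqr
  have hSlam (ω : Ω) : ‖(S ω)⁻¹‖ ≤ 1 / lam := by
    rw [one_div]; exact ((hS ω).inv hlam).2
  have hSG (ω : Ω) : ‖(S ω)⁻¹‖ ≤ G ω := by
    by_cases hω : ω ∈ B
    · simp only [G, Set.indicator_of_mem hω]
      linarith [hSlam ω]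
    · simp only [G, Set.indicator_of_notMem hω, add_zero]
      have hUle : U ω ≤ b / 2 := not_lt.1 hω
      have := (hS ω).norm_inv_le_of_close (B := EA) (c := b / 2) (by positivity)
        (by linarith [hTU ω])
      rwa [inv_div] at this
  have hfirst : ∃ g : Ω → ℝ, AEStronglyMeasurable g μ ∧ (∀ ω, ‖(S ω)⁻¹‖ * (lam * τ) ≤ g ω) ∧
      eLpNorm g (ENNReal.ofReal q) μ ≤
        ENNReal.ofReal (τ * (γq * lam + 4 * D ^ 3 * √r * γr * Q)) := by
    rcases le_or_gt (8 * D ^ 3 * K) b with hl | hl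
    · refine ⟨fun ω => lam * τ * G ω, hGmeas.const_mul _, fun ω => ?_, ?_⟩
      · exact (mul_comm _ _).trans_le (mul_le_mul_of_nonneg_left (hSG ω) (by positivity))
      · refine (eLpNorm_const_smul_le (c := lam * τ) (f := G)).trans ?_
        rw [Real.enorm_eq_ofReal (by positivity)]
        refine (mul_le_mul_right (hG1 hl) _).trans ?_
        rw [← ENNReal.ofReal_mul (by positivity)]
        refine ENNReal.ofReal_le_ofReal ?_
        calc lam * τ * (2 / b + gammaTail (1 / (32 * D ^ 4)) q lam b K) ≤ lam * τ * γq := by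
              gcongr
          _ = τ * (γq * lam) := by ring
          _ ≤ _ := by
              gcongr
              have : 0 ≤ 4 * D ^ 3 * √r * γr * Q := by positivity
              linarith
    · refine ⟨fun _ => τ, aestronglyMeasurable_const, fun ω => ?_, ?_⟩
      · calc ‖(S ω)⁻¹‖ * (lam * τ) ≤ 1 / lam * (lam * τ) := by
              have := hSlam ω
              gcongr
          _ = τ := by field_simp
      · rw [eLpNorm_const' _ (by simp; linarith) (by simp)]
        simp only [measure_univ, ENNReal.one_rpow, mul_one, Real.enorm_eq_ofReal hτ.le]
        refine ENNReal.ofReal_le_ofReal (le_mul_of_one_le_right hτ.le ?_)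
        have h1 : 1 ≤ 4 * D ^ 3 * (2 / b) * K := by
          rw [show 4 * D ^ 3 * (2 / b) * K = 8 * D ^ 3 * K / b by ring, one_le_div hb]
          exact hl.le
        have h2 : 4 * D ^ 3 * (2 / b) * K ≤ 4 * D ^ 3 * √r * γr * Q := by
          calc 4 * D ^ 3 * (2 / b) * K ≤ 4 * D ^ 3 * γr * Q := by
                gcongr
                linarith
            _ = 4 * D ^ 3 * 1 * γr * Q := by ring
            _ ≤ _ := by gcongr
        have h3 : 0 ≤ γq * lam := by positivity
        linarith
  obtain ⟨g, hgmeas, hgle, hg⟩ := hfirst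
  have hsecond : eLpNorm (fun ω => G ω * R ω) (ENNReal.ofReal q) μ ≤
      ENNReal.ofReal (τ * (16 * D ^ 4 * √r * γr * Q)) := by
    refine (eLpNorm_mul_le_of_two_mul hGmeas hRmeas (by linarith)).trans
      ((mul_le_mul' hG2 hR).trans ?_)
    rw [← ENNReal.ofReal_mul (by positivity)]
    refine ENNReal.ofReal_le_ofReal ?_
    calc _ ≤ 2 * D ^ 2 * γr * (8 * D ^ 2 * √r * (τ * Q)) := by gcongr
      _ = _ := by ring
  have hpt (ω : Ω) : ‖θhat ω - θstar‖ ≤ g ω + G ω * R ω := by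
    rw [hθhat]
    refine ((hS ω).norm_estimator_sub_le hlam _ _).trans (add_le_add (hgle ω) ?_)
    exact mul_le_mul (hSG ω) (hnoise ω) (norm_nonneg _) ((norm_nonneg _).trans (hSG ω))
  refine ENNReal.div_le_of_le_mul ?_
  refine (eLpNorm_mono_real hpt).trans ((eLpNorm_add_le hgmeas (hGmeas.mul hRmeas)
    (by simpa using hq1)).trans ((add_le_add hg hsecond).trans ?_))
  rw [← ENNReal.ofReal_add (by positivity) (by positivity), ← ENNReal.ofReal_mul (by positivity)]
  refine ENNReal.ofReal_le_ofReal (le_of_eq ?_)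
  ring
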